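/- **Setting.** For $f:\mathbf R^2\to\mathbf C$ let $R[f](\xi,\eta)=\int_{\mathbf R}f(x,\xi x+\eta)\,dx$. Call $\varphi$ a test function if $\varphi\in C^\infty(\mathbf R)$, $\varphi\ge 0$, $\operatorname{supp}\varphi\subset[-1,1]$, $\varphi$ is even and $\int\varphi=1$; put $\varphi_s(t)=\frac1s\varphi(t/s)$. For $\varepsilon,\gamma>0$ let $\mathcal M_{\varepsilon,\gamma}[f](0)=f(0,\gamma)$ and, for $x\ne0$, $$\mathcal M_{\varepsilon,\gamma}[f](x)=\mathcal M_{\varphi,\varepsilon,\gamma}[f](x)=\int_{|y-\gamma|\le\varepsilon|x|}f(x,y)\,\varphi_{\varepsilon|x|}(\gamma-y)\,dy .$$ Let $R_{\varepsilon,\gamma}=\{(\xi,\eta):|\xi|\le\varepsilon,\ -\max(\gamma,\varepsilon^2/4)\le\eta\le\gamma\}$ (if $\gamma\ge\varepsilon^2/4$, this is $|\xi|\le\varepsilon$, $|\eta|\le\gamma$). For a fixed constant $c_0>0$, $\|\cdot\|_{\varepsilon,\gamma}$ denotes any norm (or, more generally, any real-valued functional) on functions of $(\xi,\eta)$ such that,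 for all continuous $g$, $$\max\{\|g\|_{L^1(R_{\varepsilon,\gamma})},\ \|g(\cdot,\gamma)\|_{L^1[-\varepsilon,\varepsilon]}\}\le c_0\|g\|_{\varepsilon,\gamma};$$ an example, for $0<\varepsilon,\gamma<1$ and with $c_0=2$, is $\|g\|_{\varepsilon,\gamma}=\sup\{\|g(\cdot,\eta)\|_{L^1[-\varepsilon,\varepsilon]}:-\max(\gamma,\varepsilon^2/4)\le\eta\le\gamma\}$. **Theorem.** Let $c_0>0$. There are a constant $C\ge1$ (depending only on $c_0$), numbers $M=M(C_0)>0$ for $C_0\ge0$ (depending only on $c_0$ and $C_0$), and for all $\alpha,\rho$ with $\frac12<\alpha\le1$ and $0<\rho<\alpha-\frac12$ a constant $c>0$ (depending only on $c_0,\alpha,\rho$) such that the following holds. For all $C_0\ge0$ and $0<\varepsilon<1$ there is $\delta\in(0,M)$, depending only on $c_0,\alpha,\rho,C_0,\varepsilon$, such that whenever $0<\gamma\le1-\varepsilon$, $\|\cdot\|_{\varepsilon,\gamma}$ is as above, $\varphi$ is a test function, $f$ satisfies $$|f(p)-f(q)|\le C_0|p-q|^\alpha\quad(p,q\in\mathbf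 R^2),\qquad \operatorname{supp}f\subset\{(x,y):y\ge x^2\},$$ and $\|R[f]\|_{\varepsilon,\gamma}<\delta$, then $$\sup_{|x|\le1/2}|\mathcal M_{\varepsilon,\gamma}[f](x)|\le c\,M\left(\frac{\log(C/\varepsilon)}{\log\bigl(M/\|R[f]\|_{\varepsilon,\gamma}\bigr)}\right)^{\rho},$$ where the right-hand side is read as $0$ if $\|R[f]\|_{\varepsilon,\gamma}=0$. -/

import Mathlib

open MeasureTheory Set Real
open scoped NNReal ContDiff

/-- The Radon transform `R[f](ξ, η) = ∫ f(x, ξ x + η) dx`: the integral of `f` over the line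
`y = ξ x + η`, parametrized by `x`. -/
noncomputable def radon (f : EuclideanSpace ℝ (Fin 2) → ℂ) (ξ η : ℝ) : ℂ :=
  ∫ x : ℝ, f !₂[x, ξ * x + η]

/-- Admissible test functions: nonnegative, even, smooth, supported in `[-1, 1]`, of integral 1. -/
structure IsTestFunction (φ : ℝ → ℝ) : Prop where
  smooth : ContDiff ℝ ∞ φ
  supp : tsupport φ ⊆ Icc (-1) 1
  nonneg : ∀ t, 0 ≤ φ t
  even : ∀ t, φ (-t) = φ t
  integral_eq_one : ∫ t, φ t = 1

/-- The dilation `φ_s(t) = φ(t / s) / s`. -/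
noncomputable def dilate (φ : ℝ → ℝ) (s t : ℝ) : ℝ := 1 / s * φ (t / s)

/-- The mean `M_{φ,ε,γ}[f](x) = ∫_{|y - γ| ≤ ε|x|} f(x, y) φ_{ε|x|}(γ - y) dy` for `x ≠ 0`, and
`M_{φ,ε,γ}[f](0) = f(0, γ)`. -/
noncomputable def radonMean (φ : ℝ → ℝ) (ε γ : ℝ) (f : EuclideanSpace ℝ (Fin 2) → ℂ)
    (x : ℝ) : ℂ :=
  if x = 0 then f !₂[0, γ]
  else ∫ y in {y : ℝ | |y - γ| ≤ ε * |x|}, f !₂[x, y] * (dilate φ (ε * |x|) (γ - y) : ℂ)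

/-- The set of line parameters `|ξ| ≤ ε`, `-max(γ, ε²/4) ≤ η ≤ γ`. If `γ ≥ ε²/4` this is the
rectangle `|ξ| ≤ ε`, `|η| ≤ γ`. -/
def dataRect (ε γ : ℝ) : Set (ℝ × ℝ) :=
  Icc (-ε) ε ×ˢ Icc (-max γ (ε ^ 2 / 4)) γ

/-- `nrm` is an admissible way to measure the data near the origin, with constant `c₀`: up to `c₀`
it controls the `L¹` norm of the data `g` on the rectangle `dataRect ε γ` and the `L¹` norm of
`g(·, γ)` on `[-ε, ε]`. (All norms with this property are admitted; the norm laws are not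
needed.) -/
def IsDataNorm (c₀ ε γ : ℝ) (nrm : (ℝ → ℝ → ℂ) → ℝ) : Prop :=
  ∀ g : ℝ → ℝ → ℂ, Continuous (Function.uncurry g) →
    max (∫ p in dataRect ε γ, ‖g p.1 p.2‖) (∫ ξ in Icc (-ε) ε, ‖g ξ γ‖) ≤ c₀ * nrm g

/-- The standard example `sup_η ‖g(·, η)‖_{L¹[-ε, ε]}`, with `-max(γ, ε²/4) ≤ η ≤ γ`. -/
noncomputable def supDataNorm (ε γ : ℝ) (g : ℝ → ℝ → ℂ) : ℝ :=
  ⨆ η : Icc (-max γ (ε ^ 2 / 4)) γ, ∫ ξ in Icc (-ε) ε, ‖g ξ η‖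

theorem isDataNorm_supDataNorm {ε γ : ℝ} (hε : 0 < ε) (hε1 : ε < 1) (hγ : 0 < γ) (hγ1 : γ < 1) :
    IsDataNorm 2 ε γ (supDataNorm ε γ) := by
  intro g hg
  have hn : Continuous fun p : ℝ × ℝ => ‖g p.1 p.2‖ := hg.norm
  have hcont : Continuous fun η : ℝ => ∫ ξ in Icc (-ε) ε, ‖g ξ η‖ :=
    continuous_parametric_integral_of_continuous
      (f := fun η ξ => ‖g ξ η‖) (by
        exact hn.comp (continuous_snd.prodMk continuous_fst)) isCompact_Icc
  have hbdd : BddAbove (range fun η : Icc (-max γ (ε ^ 2 / 4)) γ =>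
      ∫ ξ in Icc (-ε) ε, ‖g ξ η‖) := by
    have := (isCompact_Icc (a := -max γ (ε ^ 2 / 4)) (b := γ)).bddAbove_image hcont.continuousOn
    refine this.mono ?_
    rintro _ ⟨η, rfl⟩
    exact ⟨η, η.2, rfl⟩
  have hle : ∀ η ∈ Icc (-max γ (ε ^ 2 / 4)) γ,
      ∫ ξ in Icc (-ε) ε, ‖g ξ η‖ ≤ supDataNorm ε γ g := fun η h =>
    le_ciSup hbdd (⟨η, h⟩ : Icc (-max γ (ε ^ 2 / 4)) γ)
  have hmem : γ ∈ Icc (-max γ (ε ^ 2 / 4)) γ :=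
    ⟨by have := le_max_left γ (ε ^ 2 / 4); linarith, le_rfl⟩
  have h0 : 0 ≤ supDataNorm ε γ g :=
    (integral_nonneg fun _ => norm_nonneg _).trans (hle γ hmem)
  have hmax : max γ (ε ^ 2 / 4) ≤ 1 := max_le hγ1.le (by nlinarith)
  refine max_le ?_ (by linarith [hle γ hmem])
  have hint : IntegrableOn (fun p : ℝ × ℝ => ‖g p.1 p.2‖)
      (Icc (-ε) ε ×ˢ Icc (-max γ (ε ^ 2 / 4)) γ) (volume.prod volume) := by
    rw [← Measure.volume_eq_prod]
    exact hn.continuousOn.integrableOn_compact (isCompact_Icc.prod isCompact_Icc)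
  have hsw : ∫ p in dataRect ε γ, ‖g p.1 p.2‖ =
      ∫ η in Icc (-max γ (ε ^ 2 / 4)) γ, ∫ ξ in Icc (-ε) ε, ‖g ξ η‖ := by
    rw [dataRect, Measure.volume_eq_prod, setIntegral_prod _ hint]
    refine integral_integral_swap (f := fun ξ η => ‖g ξ η‖) ?_
    rw [Measure.prod_restrict]
    exact hint
  rw [hsw]
  calc ∫ η in Icc (-max γ (ε ^ 2 / 4)) γ, ∫ ξ in Icc (-ε) ε, ‖g ξ η‖
      ≤ ∫ _ in Icc (-max γ (ε ^ 2 / 4)) γ, supDataNorm ε γ g :=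
        setIntegral_mono_on (hcont.continuousOn.integrableOn_compact isCompact_Icc)
          (integrableOn_const (by simp)) measurableSet_Icc hle
    _ = (γ + max γ (ε ^ 2 / 4)) * supDataNorm ε γ g := by
        rw [setIntegral_const, smul_eq_mul, measureReal_def, Real.volume_Icc,
          ENNReal.toReal_ofReal (by linarith [hmem.1])]
        ring
    _ ≤ 2 * supDataNorm ε γ g := by gcongr; linarith

/-! The values of $f$ on the lines $y=\xi x+\gamma$, $|\xi|\le\varepsilon$, are recovered from
moments. Let $g_l$ be the $l$-fold primitive of $f$ in $y$ and $E_{p,l}(\xi)=\int_{-1}^1x^p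
g_l(x,\xi x+\gamma)\,dx$. By the chain rule $\partial_\xi E_{p,l+1}=E_{p+1,l}$, so the moment
$E_{p,0}$ is the $p$-th $\xi$-derivative of $E_{0,p}$. Since $f$ vanishes below the parabola,
$E_{0,p}$ is a $p$-fold primitive of $R[f]$ in $\eta$, and the data bound it
(`integral_norm_lineMoment_le`).

The derivatives are moved by parts onto a weight $(\xi-a)^{2n}(b-\xi)^{2n}$ with $b-a=\varepsilon/n$
(`norm_integral_weight_smul_le`). This bounds the pairing of $f$ with that weight times any monomial
$x^k$, $k\le2n$, hence with the weight times the Landau kernel $(1-(x-x_0)^2/4)^n$. Weight and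
kernel concentrate at $(\xi_0,x_0)$, so by Hölder continuity the normalized pairing differs from
$f(x_0,\xi_0x_0+\gamma)$ by $O(C_0n^{-\alpha/2})$ (`norm_sub_pencilPairing_le`). Dividing by the
mass gives $|f|\le19C_0n^{-\alpha/2}+(8n/\varepsilon)^{8n}c_0\|R[f]\|$ at such points.

With $L=\log(1/\|R[f]\|)$ and $n\approx L^\theta$, $2\rho/\alpha<\theta<1$, the right side is at
most $L^{-\rho}$ for large $L$ (`exists_parameter`). The mean only averages values of $f$ at such
points. -/

/-! ### Iterated primitives and moments along lines. -/

/-- The `l`-fold antiderivative of `g` in the second variable, based at `0`. -/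
noncomputable def iterPrimitive (g : ℝ → ℝ → ℂ) : ℕ → ℝ → ℝ → ℂ
  | 0 => g
  | l + 1 => fun x y => ∫ u in (0 : ℝ)..y, iterPrimitive g l x u

theorem continuous_iterPrimitive {g : ℝ → ℝ → ℂ} (hg : Continuous (Function.uncurry g)) (l : ℕ) :
    Continuous (Function.uncurry (iterPrimitive g l)) := by
  induction l with
  | zero => exact hg
  | succ l ih =>
    refine intervalIntegral.continuous_parametric_intervalIntegral_of_continuous
      (f := fun (p : ℝ × ℝ) u => iterPrimitive g l p.1 u) ?_ continuous_snd
    exact ih.comp ((continuous_fst.comp continuous_fst).prodMk continuous_snd)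

theorem Continuous.iterPrimitive {X : Type*} [TopologicalSpace X] {g : ℝ → ℝ → ℂ}
    (hg : Continuous (Function.uncurry g)) (l : ℕ) {u v : X → ℝ} (hu : Continuous u)
    (hv : Continuous v) : Continuous fun q => iterPrimitive g l (u q) (v q) :=
  (continuous_iterPrimitive hg l).comp (hu.prodMk hv)

/-- The base point $0$ satisfies $0\le x^2$, so the whole interval of integration stays in the
region $u\le x^2$. -/
theorem iterPrimitive_eq_zero {g : ℝ → ℝ → ℂ} (h0 : ∀ x y, y ≤ x ^ 2 → g x y = 0) (l : ℕ) :
    ∀ x y, y ≤ x ^ 2 → iterPrimitive g l x y = 0 := by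
  induction l with
  | zero => exact h0
  | succ l ih =>
    intro x y hy
    refine (intervalIntegral.integral_congr (g := fun _ => (0 : ℂ)) fun u hu => ?_).trans (by simp)
    exact ih x u (hu.2.trans (sup_le (sq_nonneg x) hy))

theorem hasDerivAt_iterPrimitive {g : ℝ → ℝ → ℂ} (hg : Continuous (Function.uncurry g)) (l : ℕ)
    (x y : ℝ) :
    HasDerivAt (iterPrimitive g (l + 1) x) (iterPrimitive g l x y) y := by
  have hc : Continuous (iterPrimitive g l x) :=
    (continuous_iterPrimitive hg l).comp (continuous_const.prodMk continuous_id)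
  exact (hc.integral_hasStrictDerivAt 0 y).hasDerivAt

/-- The moment `∫_{-1}^1 x^p g_l(x, ξ x + γ) dx` of the `l`-fold antiderivative `g_l` of `g` along
the line with parameters `(ξ, γ)`. -/
noncomputable def lineMoment (g : ℝ → ℝ → ℂ) (p l : ℕ) (ξ γ : ℝ) : ℂ :=
  ∫ x in (-1 : ℝ)..1, x ^ p • iterPrimitive g l x (ξ * x + γ)

theorem continuous_lineMoment {g : ℝ → ℝ → ℂ} (hg : Continuous (Function.uncurry g)) (p l : ℕ) :
    Continuous (Function.uncurry (lineMoment g p l)) := by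
  refine intervalIntegral.continuous_parametric_intervalIntegral_of_continuous'
    (f := fun (q : ℝ × ℝ) x => x ^ p • iterPrimitive g l x (q.1 * x + q.2)) ?_ _ _
  exact (continuous_snd.pow p).smul (hg.iterPrimitive l continuous_snd (by fun_prop))

/-- Differentiating in the slope trades one primitive in $y$ for one factor $x$. The right side is
integrated in $\xi$ and the integrals swapped; the fundamental theorem of calculus then applies,
with no differentiation under the integral sign. -/
theorem hasDerivAt_lineMoment {g : ℝ → ℝ → ℂ} (hg : Continuous (Function.uncurry g)) (p l : ℕ)
    (γ ξ : ℝ) :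
    HasDerivAt (fun ξ => lineMoment g p (l + 1) ξ γ) (lineMoment g (p + 1) l ξ γ) ξ := by
  have hE : Continuous fun ξ => lineMoment g (p + 1) l ξ γ :=
    (continuous_lineMoment hg (p + 1) l).comp (continuous_id.prodMk continuous_const)
  have key : ∀ ξ, lineMoment g p (l + 1) ξ γ =
      lineMoment g p (l + 1) 0 γ + ∫ τ in (0 : ℝ)..ξ, lineMoment g (p + 1) l τ γ := by
    intro ξ
    have hF : Continuous (Function.uncurry fun τ x : ℝ =>
        x ^ (p + 1) • iterPrimitive g l x (τ * x + γ)) :=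
      (continuous_snd.pow (p + 1)).smul (hg.iterPrimitive l continuous_snd (by fun_prop))
    have hs : ∫ τ in (0 : ℝ)..ξ, lineMoment g (p + 1) l τ γ =
        ∫ x in (-1 : ℝ)..1, ∫ τ in (0 : ℝ)..ξ,
          x ^ (p + 1) • iterPrimitive g l x (τ * x + γ) := by
      refine intervalIntegral_intervalIntegral_swap ?_
      exact (hF.continuousOn.integrableOn_compact
        (isCompact_uIcc.prod isCompact_uIcc)).mono_set
        (prod_mono uIoc_subset_uIcc uIoc_subset_uIcc)
    have hi : ∀ x : ℝ, ∫ τ in (0 : ℝ)..ξ, x ^ (p + 1) • iterPrimitive g l x (τ * x + γ) =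
        x ^ p • iterPrimitive g (l + 1) x (ξ * x + γ) -
          x ^ p • iterPrimitive g (l + 1) x (0 * x + γ) := by
      intro x
      refine intervalIntegral.integral_eq_sub_of_hasDerivAt
        (f := fun τ => x ^ p • iterPrimitive g (l + 1) x (τ * x + γ)) (fun τ _ => ?_) ?_
      · have h1 : HasDerivAt (fun τ : ℝ => τ * x + γ) x τ := by
          simpa using ((hasDerivAt_id τ).mul_const x).add_const γ
        have h2 := ((hasDerivAt_iterPrimitive hg l x (τ * x + γ)).scomp τ h1).const_smul (x ^ p)
        rw [smul_smul, ← pow_succ] at h2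
        exact h2
      · exact (hF.comp (continuous_id.prodMk continuous_const)).intervalIntegrable _ _
    have hc : ∀ τ, Continuous fun x : ℝ => x ^ p • iterPrimitive g (l + 1) x (τ * x + γ) :=
      fun τ => (continuous_id.pow p).smul
        (hg.iterPrimitive (l + 1) continuous_id (by fun_prop))
    rw [hs]
    simp_rw [hi]
    rw [intervalIntegral.integral_sub ((hc ξ).intervalIntegrable _ _)
      ((hc 0).intervalIntegrable _ _), lineMoment, lineMoment]
    abel
  have := ((hE.integral_hasStrictDerivAt 0 ξ).hasDerivAt).const_add (lineMoment g p (l + 1) 0 γ)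
  exact this.congr_of_eventuallyEq (Filter.Eventually.of_forall key)

/-! ### Integration by parts, polynomial expansion and the Landau kernel. -/

/-- Repeated integration by parts against the weights `(ξ - a)^i (b - ξ)^j`. -/
theorem norm_integral_weight_smul_le {E : ℕ → ℕ → ℝ → ℂ} (hE : ∀ p l, Continuous (E p l))
    (hd : ∀ p l ξ, HasDerivAt (E p (l + 1)) (E (p + 1) l ξ) ξ) {a b : ℝ} (hab : a ≤ b)
    (hab1 : b ≤ a + 1) (m : ℕ) (D : ℕ → ℝ) (hD : ∀ l, ∫ ξ in a..b, ‖E 0 l ξ‖ ≤ D l) (p : ℕ) :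
    ∀ i j l : ℕ, p ≤ i → p ≤ j → i ≤ m → j ≤ m →
      ‖∫ ξ in a..b, ((ξ - a) ^ i * (b - ξ) ^ j) • E p l ξ‖ ≤ (2 * m) ^ p * D (l + p) := by
  induction p with
  | zero =>
    intro i j l _ _ _ _
    simp only [pow_zero, one_mul, add_zero]
    refine (intervalIntegral.norm_integral_le_integral_norm hab).trans (le_trans ?_ (hD l))
    have hc := hE 0 l
    refine intervalIntegral.integral_mono_on hab (by apply Continuous.intervalIntegrable; fun_prop)
      (by apply Continuous.intervalIntegrable; fun_prop) fun ξ hξ => ?_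
    rw [norm_smul]
    refine mul_le_of_le_one_left (norm_nonneg _) ?_
    rw [Real.norm_eq_abs, abs_mul, abs_pow, abs_pow]
    refine mul_le_one₀ (pow_le_one₀ (abs_nonneg _) ?_) (by positivity)
      (pow_le_one₀ (abs_nonneg _) ?_) <;> rw [abs_le] <;> constructor <;> linarith [hξ.1, hξ.2]
  | succ p ih =>
    intro i j l hi hj him hjm
    obtain ⟨i, rfl⟩ : ∃ i', i = i' + 1 := ⟨i - 1, by omega⟩
    obtain ⟨j, rfl⟩ : ∃ j', j = j' + 1 := ⟨j - 1, by omega⟩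
    have hc := hE p (l + 1)
    have hu : ∀ ξ : ℝ, HasDerivAt (fun ξ : ℝ => (ξ - a) ^ (i + 1) * (b - ξ) ^ (j + 1))
        ((i + 1 : ℝ) * ((ξ - a) ^ i * (b - ξ) ^ (j + 1)) -
          (j + 1 : ℝ) * ((ξ - a) ^ (i + 1) * (b - ξ) ^ j)) ξ := by
      intro ξ
      have h1 := ((hasDerivAt_id ξ).sub_const a).pow (i + 1)
      have h2 := ((hasDerivAt_id ξ).const_sub b).pow (j + 1)
      refine (h1.mul h2).congr_deriv ?_
      simp
      ring
    have hparts := intervalIntegral.integral_smul_deriv_eq_deriv_smul (a := a) (b := b)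
      (fun ξ _ => hu ξ) (fun ξ _ => hd p l ξ)
      (by apply Continuous.intervalIntegrable; fun_prop)
      ((hE (p + 1) l).intervalIntegrable _ _)
    rw [hparts]
    have hsplit : ∫ ξ in a..b, ((i + 1 : ℝ) * ((ξ - a) ^ i * (b - ξ) ^ (j + 1)) -
          (j + 1 : ℝ) * ((ξ - a) ^ (i + 1) * (b - ξ) ^ j)) • E p (l + 1) ξ =
        (i + 1 : ℝ) • (∫ ξ in a..b, ((ξ - a) ^ i * (b - ξ) ^ (j + 1)) • E p (l + 1) ξ) -
        (j + 1 : ℝ) • ∫ ξ in a..b, ((ξ - a) ^ (i + 1) * (b - ξ) ^ j) • E p (l + 1) ξ := by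
      rw [← intervalIntegral.integral_smul, ← intervalIntegral.integral_smul,
        ← intervalIntegral.integral_sub (by apply Continuous.intervalIntegrable; fun_prop)
          (by apply Continuous.intervalIntegrable; fun_prop)]
      simp_rw [sub_smul, mul_smul]
    rw [hsplit]
    -- Both exponents are positive, so the boundary terms vanish. The two remaining integrals each
    -- have one exponent lowered and a coefficient at most $m$, whence the factor $2m$ per step.
    simp only [sub_self, zero_pow (Nat.succ_ne_zero _), mul_zero, zero_mul, zero_smul, zero_sub,
      norm_neg]
    have e1 := ih i (j + 1) (l + 1) (by omega) (by omega) (by omega) hjm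
    have e2 := ih (i + 1) j (l + 1) (by omega) (by omega) him (by omega)
    have hi' : (i + 1 : ℝ) ≤ m := by exact_mod_cast him
    have hj' : (j + 1 : ℝ) ≤ m := by exact_mod_cast hjm
    rw [show l + 1 + p = l + (p + 1) by ring] at e1 e2
    refine (norm_sub_le _ _).trans ?_
    rw [norm_smul, norm_smul, Real.norm_of_nonneg (by positivity),
      Real.norm_of_nonneg (by positivity)]
    calc _ ≤ m * ((2 * m) ^ p * D (l + (p + 1))) + m * ((2 * m) ^ p * D (l + (p + 1))) := by
          gcongr
      _ = _ := by ring

/-- Bounds for the monomial moments of a linear functional give bounds against powers of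
`1 - (x - x₀)² / 4`. -/
theorem norm_le_of_moments {T : (ℝ → ℝ) → ℂ} {x₀ : ℝ} (hx₀ : |x₀| ≤ 1) {N : ℕ} {B : ℝ}
    (hT : ∀ k ≤ N, ‖T fun x => x ^ k‖ ≤ B)
    (hrec : ∀ p j, T (fun x => x ^ p * (1 - (x - x₀) ^ 2 / 4) ^ (j + 1)) =
      (1 - x₀ ^ 2 / 4) • T (fun x => x ^ p * (1 - (x - x₀) ^ 2 / 4) ^ j) +
      (x₀ / 2) • T (fun x => x ^ (p + 1) * (1 - (x - x₀) ^ 2 / 4) ^ j) -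
      (1 / 4 : ℝ) • T (fun x => x ^ (p + 2) * (1 - (x - x₀) ^ 2 / 4) ^ j)) (j : ℕ) :
    ∀ p, p + 2 * j ≤ N → ‖T fun x => x ^ p * (1 - (x - x₀) ^ 2 / 4) ^ j‖ ≤ 2 ^ j * B := by
  induction j with
  | zero => intro p hp; simpa using hT p (by omega)
  | succ j ih =>
    intro p hp
    rw [hrec]
    obtain ⟨h1, h2⟩ := abs_le.1 hx₀
    have e0 := ih p (by omega)
    have e1 := ih (p + 1) (by omega)
    have e2 := ih (p + 2) (by omega)
    have a0 : ‖1 - x₀ ^ 2 / 4‖ ≤ 1 := by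
      rw [Real.norm_eq_abs, abs_le]; constructor <;> nlinarith
    have a1 : ‖x₀ / 2‖ ≤ 1 / 2 := by
      rw [Real.norm_eq_abs, abs_le]; constructor <;> linarith
    have a2 : ‖(1 / 4 : ℝ)‖ ≤ 1 / 4 := by norm_num
    have hB : 0 ≤ 2 ^ j * B := (norm_nonneg _).trans e0
    refine (norm_sub_le _ _).trans ((add_le_add_left (norm_add_le _ _) _).trans ?_)
    rw [norm_smul, norm_smul, norm_smul]
    -- The coefficients of $1-(x-x_0)^2/4$ in powers of $x$ have absolute sum at most $7/4\le2$.
    calc _ ≤ 1 * (2 ^ j * B) + 1 / 2 * (2 ^ j * B) + 1 / 4 * (2 ^ j * B) := by gcongr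
      _ ≤ 2 ^ (j + 1) * B := by rw [pow_succ]; linarith

/-- The second moment of the Landau kernel is `O(1 / n)` times its mass. -/
theorem integral_sq_mul_landau_le {x₀ : ℝ} (hx₀ : |x₀| ≤ 1) (n : ℕ) :
    ∫ x in (-1 : ℝ)..1, (x - x₀) ^ 2 * (1 - (x - x₀) ^ 2 / 4) ^ n ≤
      2 / ((n : ℝ) + 1) * ∫ x in (-1 : ℝ)..1, (1 - (x - x₀) ^ 2 / 4) ^ n := by
  obtain ⟨h1, h2⟩ := abs_le.1 hx₀
  have hn : (0 : ℝ) < n + 1 := by positivity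
  have hk : ∀ x ∈ Icc (-1 : ℝ) 1, 0 ≤ 1 - (x - x₀) ^ 2 / 4 := fun x hx => by
    have : |x - x₀| ≤ 2 := by rw [abs_le]; constructor <;> linarith [hx.1, hx.2]
    have := sq_le_sq' (by linarith [abs_le.1 this]) (abs_le.1 this).2
    linarith
  -- Integrating this derivative over $[-1,1]$ trades the second moment for mass; as $|x_0|\le1$,
  -- the boundary terms have the favourable sign.
  have hder : ∀ x : ℝ, HasDerivAt (fun x => (x - x₀) * (1 - (x - x₀) ^ 2 / 4) ^ (n + 1))
      ((1 - (x - x₀) ^ 2 / 4) ^ (n + 1) -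
        (n + 1) / 2 * ((x - x₀) ^ 2 * (1 - (x - x₀) ^ 2 / 4) ^ n)) x := by
    intro x
    have h := (hasDerivAt_id x).sub_const x₀
    refine (h.mul ((((h.pow 2).div_const 4).const_sub 1).pow (n + 1))).congr_deriv ?_
    simp
    ring
  have hftc := intervalIntegral.integral_eq_sub_of_hasDerivAt (a := -1) (b := 1)
    (fun x _ => hder x) (by apply Continuous.intervalIntegrable; fun_prop)
  rw [intervalIntegral.integral_sub (by apply Continuous.intervalIntegrable; fun_prop)
    (by apply Continuous.intervalIntegrable; fun_prop),
    intervalIntegral.integral_const_mul] at hftc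
  have hb : 0 ≤ (1 - x₀) * (1 - (1 - x₀) ^ 2 / 4) ^ (n + 1) -
      (-1 - x₀) * (1 - (-1 - x₀) ^ 2 / 4) ^ (n + 1) := by
    have e1 := mul_nonneg (sub_nonneg.2 h2) (pow_nonneg (hk 1 (by simp)) (n + 1))
    have e2 := mul_nonneg (by linarith : 0 ≤ 1 + x₀) (pow_nonneg (hk (-1) (by simp)) (n + 1))
    linarith
  have hm : ∫ x in (-1 : ℝ)..1, (1 - (x - x₀) ^ 2 / 4) ^ (n + 1) ≤
      ∫ x in (-1 : ℝ)..1, (1 - (x - x₀) ^ 2 / 4) ^ n := by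
    refine intervalIntegral.integral_mono_on (by norm_num)
      (by apply Continuous.intervalIntegrable; fun_prop)
      (by apply Continuous.intervalIntegrable; fun_prop) fun x hx => ?_
    rw [pow_succ]
    exact mul_le_of_le_one_right (pow_nonneg (hk x hx) n) (by nlinarith [sq_nonneg (x - x₀)])
  rw [div_mul_eq_mul_div, le_div_iff₀ hn]
  linarith

/-! ### Primitives of the data in the intercept. -/

/-- The line $y=\xi x-\beta$ lies below the parabola, because $x^2-\xi x+\xi^2/4\ge0$ and
$\xi^2/4\le\beta$. Hence the primitive in $\eta$ may start at $-\beta$, which is why the data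
rectangle must reach down to $-\varepsilon^2/4$. -/
theorem lineMoment_succ_eq_integral {g : ℝ → ℝ → ℂ} (hg : Continuous (Function.uncurry g))
    (h0 : ∀ x y, y ≤ x ^ 2 → g x y = 0) {ε β : ℝ} (hβ : ε ^ 2 / 4 ≤ β) {ξ : ℝ} (hξ : |ξ| ≤ ε)
    (l : ℕ) (η : ℝ) :
    lineMoment g 0 (l + 1) ξ η = ∫ u in -β..η, lineMoment g 0 l ξ u := by
  have hF : Continuous (Function.uncurry fun u x : ℝ => iterPrimitive g l x (ξ * x + u)) :=
    hg.iterPrimitive l continuous_snd (by fun_prop)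
  have hs : ∫ u in -β..η, lineMoment g 0 l ξ u =
      ∫ x in (-1 : ℝ)..1, ∫ u in -β..η, iterPrimitive g l x (ξ * x + u) := by
    simp only [lineMoment, pow_zero, one_smul]
    refine intervalIntegral_intervalIntegral_swap ?_
    exact (hF.continuousOn.integrableOn_compact
      (isCompact_uIcc.prod isCompact_uIcc)).mono_set
      (prod_mono uIoc_subset_uIcc uIoc_subset_uIcc)
  have hi : ∀ x : ℝ, ∫ u in -β..η, iterPrimitive g l x (ξ * x + u) =
      iterPrimitive g (l + 1) x (ξ * x + η) := by
    intro x
    have h := intervalIntegral.integral_eq_sub_of_hasDerivAt (a := -β) (b := η)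
      (f := fun u => iterPrimitive g (l + 1) x (ξ * x + u))
      (fun u _ => (hasDerivAt_iterPrimitive hg l x (ξ * x + u)).comp_const_add (ξ * x) u)
      ((hF.comp (continuous_id.prodMk continuous_const)).intervalIntegrable _ _)
    refine h.trans ?_
    have hle : ξ * x + -β ≤ x ^ 2 := by
      have := sq_le_sq' (by linarith [abs_le.1 hξ]) (abs_le.1 hξ).2
      nlinarith [sq_nonneg (x - ξ / 2)]
    simp [iterPrimitive_eq_zero h0 (l + 1) x _ hle]
  rw [hs]
  simp_rw [hi]
  simp [lineMoment]

/-- Bounds of the iterated primitives of the data by the data. -/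
theorem integral_norm_lineMoment_le {g : ℝ → ℝ → ℂ} (hg : Continuous (Function.uncurry g))
    (h0 : ∀ x y, y ≤ x ^ 2 → g x y = 0) {ε γ τ : ℝ} (hε : 0 < ε) (hγ : 0 < γ) (hεγ : ε + γ ≤ 1)
    (h1 : ∫ p in dataRect ε γ, ‖lineMoment g 0 0 p.1 p.2‖ ≤ τ)
    (h2 : ∫ ξ in Icc (-ε) ε, ‖lineMoment g 0 0 ξ γ‖ ≤ τ) (l : ℕ) :
    ∫ ξ in Icc (-ε) ε, ‖lineMoment g 0 l ξ γ‖ ≤ 2 ^ l * τ := by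
  rcases l with _ | l
  · simpa using h2
  set β := max γ (ε ^ 2 / 4) with hβ
  have hβγ : γ ≤ β := le_max_left _ _
  have hβ1 : β ≤ 1 := max_le (by linarith) (by nlinarith)
  have hc : ∀ l, Continuous (Function.uncurry (lineMoment g 0 l)) := continuous_lineMoment hg 0
  have hc2 : ∀ l ξ, Continuous (lineMoment g 0 l ξ) := fun l ξ =>
    (hc l).comp (continuous_const.prodMk continuous_id)
  have hA : ∀ l, ∀ ξ ∈ Icc (-ε) ε, ∀ η ∈ Icc (-β) γ, ‖lineMoment g 0 (l + 1) ξ η‖ ≤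
      2 ^ l * ∫ u in -β..γ, ‖lineMoment g 0 0 ξ u‖ := by
    intro l
    induction l with
    | zero =>
      intro ξ hξ η hη
      rw [lineMoment_succ_eq_integral hg h0 (le_max_right _ _) (abs_le.2 hξ), pow_zero, one_mul]
      refine (intervalIntegral.norm_integral_le_integral_norm hη.1).trans ?_
      exact intervalIntegral.integral_mono_interval le_rfl hη.1 hη.2
        (Filter.Eventually.of_forall fun _ => norm_nonneg _)
        ((hc2 0 ξ).norm.intervalIntegrable _ _)
    | succ l ih =>
      intro ξ hξ η hη
      rw [lineMoment_succ_eq_integral hg h0 (le_max_right _ _) (abs_le.2 hξ)]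
      have hpos : 0 ≤ ∫ u in -β..γ, ‖lineMoment g 0 0 ξ u‖ :=
        intervalIntegral.integral_nonneg (by linarith) fun _ _ => norm_nonneg _
      refine (intervalIntegral.norm_integral_le_of_norm_le_const (fun u hu => ?_)).trans
        (b := 2 ^ l * (∫ u in -β..γ, ‖lineMoment g 0 0 ξ u‖) * |η - -β|) ?_
      · rw [uIoc_of_le hη.1] at hu
        exact ih ξ hξ u ⟨hu.1.le, hu.2.trans hη.2⟩
      -- Each further primitive is over an interval of length at most $\gamma+\beta\le2$.
      · have : |η - -β| ≤ 2 := by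
          rw [abs_of_nonneg (by linarith [hη.1])]; linarith [hη.2]
        calc _ ≤ 2 ^ l * (∫ u in -β..γ, ‖lineMoment g 0 0 ξ u‖) * 2 := by gcongr
          _ = _ := by ring
  have hcA : Continuous fun ξ => ∫ u in -β..γ, ‖lineMoment g 0 0 ξ u‖ :=
    intervalIntegral.continuous_parametric_intervalIntegral_of_continuous'
      (f := fun ξ u => ‖lineMoment g 0 0 ξ u‖) (hc 0).norm _ _
  have hpos : 0 ≤ ∫ p in dataRect ε γ, ‖lineMoment g 0 0 p.1 p.2‖ :=
    integral_nonneg fun _ => norm_nonneg _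
  have hrect : ∫ p in dataRect ε γ, ‖lineMoment g 0 0 p.1 p.2‖ =
      ∫ ξ in Icc (-ε) ε, ∫ u in -β..γ, ‖lineMoment g 0 0 ξ u‖ := by
    rw [dataRect, Measure.volume_eq_prod, setIntegral_prod]
    · simp_rw [intervalIntegral.integral_of_le (show -β ≤ γ by linarith), ← hβ,
        integral_Icc_eq_integral_Ioc]
    · rw [← Measure.volume_eq_prod]
      exact (hc 0).norm.continuousOn.integrableOn_compact (isCompact_Icc.prod isCompact_Icc)
  calc ∫ ξ in Icc (-ε) ε, ‖lineMoment g 0 (l + 1) ξ γ‖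
      ≤ ∫ ξ in Icc (-ε) ε, 2 ^ l * ∫ u in -β..γ, ‖lineMoment g 0 0 ξ u‖ := by
        refine setIntegral_mono_on ?_ ?_ measurableSet_Icc
          fun ξ hξ => hA l ξ hξ γ ⟨by linarith, le_rfl⟩
        · exact ((hc (l + 1)).comp (continuous_id.prodMk continuous_const)).norm.continuousOn
            |>.integrableOn_compact isCompact_Icc
        · exact (hcA.const_mul _).continuousOn.integrableOn_compact isCompact_Icc
    _ = 2 ^ l * ∫ p in dataRect ε γ, ‖lineMoment g 0 0 p.1 p.2‖ := by
        rw [integral_const_mul, hrect]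
    _ ≤ 2 ^ (l + 1) * τ := by
        have : (2 : ℝ) ^ l ≤ 2 ^ (l + 1) := pow_le_pow_right₀ (by norm_num) (by omega)
        gcongr

/-! ### The Radon transform of functions supported above the parabola. -/

/-- The functions `f` of the theorem, in coordinates. -/
structure HolderAboveParabola (C₀ : ℝ) (α : ℝ) (g : ℝ → ℝ → ℂ) : Prop where
  continuous : Continuous (Function.uncurry g)
  holder : ∀ x y x' y', ‖g x y - g x' y'‖ ≤ C₀ * (|x - x'| + |y - y'|) ^ α
  eq_zero : ∀ x y, y ≤ x ^ 2 → g x y = 0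

theorem holderAboveParabola_of_holderWith {C₀ α : ℝ≥0} (hα : 0 < α) {f : EuclideanSpace ℝ (Fin 2) → ℂ}
    (hf : HolderWith C₀ α f) (hs : tsupport f ⊆ {p | (p 0) ^ 2 ≤ p 1}) :
    HolderAboveParabola C₀ α fun x y => f !₂[x, y] := by
  have hcont : Continuous (Function.uncurry fun x y => f !₂[x, y]) :=
    (hf.continuous hα).comp (by fun_prop)
  refine ⟨hcont, fun x y x' y' => ?_, ?_⟩
  · rw [← dist_eq_norm]
    refine hf.dist_le_of_le ?_
    rw [EuclideanSpace.dist_eq, Real.sqrt_le_left (by positivity)]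
    simp only [Fin.sum_univ_two, Real.dist_eq, Fin.isValue, Matrix.cons_val_zero,
      Matrix.cons_val_one, Matrix.cons_val_fin_one]
    nlinarith [mul_nonneg (abs_nonneg (x - x')) (abs_nonneg (y - y'))]
  · intro x
    have hlt : ∀ y < x ^ 2, f !₂[x, y] = 0 := by
      intro y hy
      by_contra h
      have := hs (subset_tsupport f h)
      simp at this
      linarith
    intro y hy
    have hcl : IsClosed {y : ℝ | f !₂[x, y] = 0} :=
      isClosed_eq (hcont.comp (continuous_const.prodMk continuous_id)) continuous_const
    have hsub : closure (Iio (x ^ 2)) ⊆ {y : ℝ | f !₂[x, y] = 0} :=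
      closure_minimal (fun y hy => hlt y hy) hcl
    rw [closure_Iio] at hsub
    exact hsub hy

theorem radon_eq_intervalIntegral {f : EuclideanSpace ℝ (Fin 2) → ℂ}
    (h0 : ∀ x y, y ≤ x ^ 2 → f !₂[x, y] = 0) {r ξ η : ℝ} (hr : 0 ≤ r)
    (h : ∀ x, r < |x| → ξ * x + η ≤ x ^ 2) :
    radon f ξ η = ∫ x in -r..r, f !₂[x, ξ * x + η] := by
  rw [radon, intervalIntegral.integral_of_le (by linarith), ← integral_Icc_eq_integral_Ioc]
  refine (setIntegral_eq_integral_of_forall_compl_eq_zero fun x hx => h0 x _ (h x ?_)).symm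
  by_contra hxr
  exact hx (abs_le.1 (not_lt.1 hxr))

/-- For $|x|>r\ge\varepsilon+\gamma$ and $|x|\ge1$ one has $\xi x+\eta\le(\varepsilon+\gamma)|x|\le
x^2$. With $r=1$ this confines the line integrals to $[-1,1]$; other $r$ serve the continuity of
`radon`. -/
theorem le_sq_of_lt_abs {ε γ ξ η x : ℝ} (hγ : 0 ≤ γ) (hξ : |ξ| ≤ ε) (hη : η ≤ γ)
    {r : ℝ} (hr : 1 ≤ r) (hεγ : ε + γ ≤ r) (hx : r < |x|) : ξ * x + η ≤ x ^ 2 := by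
  have h1 : ξ * x ≤ ε * |x| := (le_abs_self _).trans (by rw [abs_mul]; gcongr)
  have h2 : γ ≤ γ * |x| := le_mul_of_one_le_right hγ (by linarith)
  rw [← sq_abs x]
  nlinarith

theorem radon_eq_lineMoment {f : EuclideanSpace ℝ (Fin 2) → ℂ}
    (h0 : ∀ x y, y ≤ x ^ 2 → f !₂[x, y] = 0) {ε γ ξ η : ℝ} (hγ : 0 ≤ γ) (hεγ : ε + γ ≤ 1)
    (hξ : |ξ| ≤ ε) (hη : η ≤ γ) :
    radon f ξ η = lineMoment (fun x y => f !₂[x, y]) 0 0 ξ η := by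
  rw [radon_eq_intervalIntegral h0 zero_le_one fun x hx => le_sq_of_lt_abs hγ hξ hη le_rfl hεγ hx]
  simp [lineMoment, iterPrimitive]

theorem continuous_radon {f : EuclideanSpace ℝ (Fin 2) → ℂ} (hf : Continuous f)
    (h0 : ∀ x y, y ≤ x ^ 2 → f !₂[x, y] = 0) : Continuous (Function.uncurry (radon f)) := by
  rw [continuous_iff_continuousAt]
  rintro ⟨ξ₀, η₀⟩
  -- For parameters bounded by $B$ the line integrals all reduce to the fixed interval $[-2B,2B]$.
  set B := |ξ₀| + |η₀| + 1 with hB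
  have hc : Continuous fun p : ℝ × ℝ => ∫ x in -(2 * B)..(2 * B), f !₂[x, p.1 * x + p.2] :=
    intervalIntegral.continuous_parametric_intervalIntegral_of_continuous'
      (f := fun (p : ℝ × ℝ) x => f !₂[x, p.1 * x + p.2]) (hf.comp (by fun_prop)) _ _
  refine hc.continuousAt.congr ?_
  have hU : {p : ℝ × ℝ | |p.1| < B ∧ |p.2| < B} ∈ nhds (ξ₀, η₀) := by
    refine IsOpen.mem_nhds ?_ ⟨?_, ?_⟩
    · exact (isOpen_lt continuous_fst.abs continuous_const).inter
        (isOpen_lt continuous_snd.abs continuous_const)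
    · simp only [hB]; linarith [abs_nonneg η₀]
    · simp only [hB]; linarith [abs_nonneg ξ₀]
  have hB1 : 1 ≤ B := by rw [hB]; linarith [abs_nonneg η₀, abs_nonneg ξ₀]
  filter_upwards [hU] with p hp
  exact (radon_eq_intervalIntegral h0 (by linarith) fun x hx =>
    le_sq_of_lt_abs (ε := B) (γ := B) (by linarith) hp.1.le ((le_abs_self _).trans hp.2.le)
      (by linarith) (by linarith) hx).symm

/-! ### Pairing with approximate identities over the pencil of lines through $(0,\gamma)$. -/

/-- From $t^\alpha\le1+t^2$: the Hölder error is then controlled by the mass and second moment of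
the kernel alone. -/
theorem rpow_le_rpow_mul_one_add_sq {α d h : ℝ} (hα0 : 0 ≤ α) (hα1 : α ≤ 1) (hd : 0 ≤ d)
    (hh : 0 < h) : d ^ α ≤ h ^ α * (1 + (d / h) ^ 2) := by
  have hu : 0 ≤ d / h := div_nonneg hd hh.le
  have key : (d / h) ^ α ≤ 1 + (d / h) ^ 2 := by
    rcases le_total (d / h) 1 with h1 | h1
    · linarith [rpow_le_one hu h1 hα0, sq_nonneg (d / h)]
    · have := rpow_le_rpow_of_exponent_le h1 hα1
      rw [rpow_one] at this
      nlinarith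
  calc d ^ α = (h * (d / h)) ^ α := by rw [mul_div_cancel₀ _ hh.ne']
    _ = h ^ α * (d / h) ^ α := mul_rpow hh.le hu
    _ ≤ _ := by gcongr

theorem intervalIntegrable_smul {w : ℝ → ℝ} {F : ℝ → ℂ} (hw : Continuous w) (hF : Continuous F)
    (a b : ℝ) : IntervalIntegrable (fun x => w x • F x) volume a b :=
  (hw.smul hF).intervalIntegrable a b

/-- The pairing of `g` with the product of the weight `P` in the slope and `q` in `x`, over the
lines through `(0, γ)`. -/
noncomputable def pencilPairing (g : ℝ → ℝ → ℂ) (γ a b : ℝ) (P q : ℝ → ℝ) : ℂ :=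
  ∫ ξ in a..b, P ξ • ∫ x in (-1 : ℝ)..1, q x • g x (ξ * x + γ)

theorem continuous_inner_pairing {g : ℝ → ℝ → ℂ} (hg : Continuous (Function.uncurry g)) (γ : ℝ)
    {q : ℝ → ℝ} (hq : Continuous q) :
    Continuous fun ξ => ∫ x in (-1 : ℝ)..1, q x • g x (ξ * x + γ) :=
  intervalIntegral.continuous_parametric_intervalIntegral_of_continuous'
    (f := fun ξ x => q x • g x (ξ * x + γ))
    ((hq.comp continuous_snd).smul (hg.iterPrimitive 0 continuous_snd (by fun_prop))) _ _

theorem pencilPairing_add {g : ℝ → ℝ → ℂ} (hg : Continuous (Function.uncurry g)) (γ a b : ℝ)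
    {P q r : ℝ → ℝ} (hP : Continuous P) (hq : Continuous q) (hr : Continuous r) :
    pencilPairing g γ a b P (fun x => q x + r x) =
      pencilPairing g γ a b P q + pencilPairing g γ a b P r := by
  have hl : ∀ ξ, Continuous fun x => g x (ξ * x + γ) := fun ξ =>
    hg.iterPrimitive 0 continuous_id (by fun_prop)
  rw [pencilPairing, pencilPairing, pencilPairing, ← intervalIntegral.integral_add
    (intervalIntegrable_smul hP (continuous_inner_pairing hg γ hq) _ _)
    (intervalIntegrable_smul hP (continuous_inner_pairing hg γ hr) _ _)]
  simp_rw [← smul_add]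
  congr! 4 with ξ
  rw [← intervalIntegral.integral_add (intervalIntegrable_smul hq (hl ξ) _ _)
    (intervalIntegrable_smul hr (hl ξ) _ _)]
  simp_rw [add_smul]

theorem pencilPairing_const_mul (g : ℝ → ℝ → ℂ) (γ a b c : ℝ) (P q : ℝ → ℝ) :
    pencilPairing g γ a b P (fun x => c * q x) = c • pencilPairing g γ a b P q := by
  simp_rw [pencilPairing, mul_smul, intervalIntegral.integral_smul, smul_comm _ c,
    intervalIntegral.integral_smul]

/-- The kernel has degree $2n$ and the weight vanishes to order $2n$ at both ends, so every monomial
needed admits enough integrations by parts. Each costs $4n$ from the weight and $2$ from the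
primitive; expanding the kernel costs $2^n$. -/
theorem norm_pencilPairing_landau_le {g : ℝ → ℝ → ℂ} (hg : Continuous (Function.uncurry g))
    {γ ε τ a b x₀ : ℝ} (hx₀ : |x₀| ≤ 1) (hab : a ≤ b) (hab1 : b ≤ a + 1) (ha : -ε ≤ a)
    (hb : b ≤ ε) (hτ : 0 ≤ τ)
    (hdata : ∀ l, ∫ ξ in Icc (-ε) ε, ‖lineMoment g 0 l ξ γ‖ ≤ 2 ^ l * τ) {n : ℕ} (hn : 1 ≤ n) :
    ‖pencilPairing g γ a b (fun ξ => (ξ - a) ^ (2 * n) * (b - ξ) ^ (2 * n))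
      fun x => (1 - (x - x₀) ^ 2 / 4) ^ n‖ ≤ 2 ^ n * ((8 * n) ^ (2 * n) * τ) := by
  have hE : ∀ p l, Continuous fun ξ => lineMoment g p l ξ γ := fun p l =>
    (continuous_lineMoment hg p l).comp (continuous_id.prodMk continuous_const)
  have hD : ∀ l, ∫ ξ in a..b, ‖lineMoment g 0 l ξ γ‖ ≤ 2 ^ l * τ := by
    intro l
    rw [intervalIntegral.integral_of_le hab]
    refine (setIntegral_mono_set ((hE 0 l).norm.continuousOn.integrableOn_compact isCompact_Icc)
      (Filter.Eventually.of_forall fun _ => norm_nonneg _) ?_).trans (hdata l)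
    exact LE.le.eventuallyLE
      (Ioc_subset_Icc_self.trans (Icc_subset_Icc ha hb))
  have hT := norm_le_of_moments (x₀ := x₀) (N := 2 * n) (B := (8 * n) ^ (2 * n) * τ)
    (T := pencilPairing g γ a b fun ξ => (ξ - a) ^ (2 * n) * (b - ξ) ^ (2 * n)) hx₀ ?_ ?_ n 0
    (by omega)
  · simpa using hT
  · intro k hk
    have h := norm_integral_weight_smul_le (E := fun p l ξ => lineMoment g p l ξ γ) hE
      (fun p l ξ => hasDerivAt_lineMoment hg p l γ ξ) hab hab1 (2 * n) (fun l => 2 ^ l * τ) hD k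
      (2 * n) (2 * n) 0 hk hk le_rfl le_rfl
    refine h.trans ?_
    have hn' : (1 : ℝ) ≤ n := by exact_mod_cast hn
    calc (2 * ((2 * n : ℕ) : ℝ)) ^ k * (2 ^ (0 + k) * τ) = (8 * n) ^ k * τ := by
          rw [zero_add, ← mul_assoc, ← mul_pow]; push_cast; ring_nf
      _ ≤ (8 * n) ^ (2 * n) * τ := by
          gcongr
          linarith
  · intro p j
    have hP : Continuous fun ξ : ℝ => (ξ - a) ^ (2 * n) * (b - ξ) ^ (2 * n) := by fun_prop
    rw [sub_eq_add_neg, ← neg_smul, ← pencilPairing_const_mul, ← pencilPairing_const_mul,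
      ← pencilPairing_const_mul, ← pencilPairing_add hg γ a b hP (by fun_prop) (by fun_prop),
      ← pencilPairing_add hg γ a b hP (by fun_prop) (by fun_prop)]
    congr 1
    ext x
    ring

/-- Approximation of a point value by the pairing with approximate identities. -/
theorem norm_sub_pencilPairing_le {C₀ α : ℝ} {g : ℝ → ℝ → ℂ} (hg : HolderAboveParabola C₀ α g)
    (hC₀ : 0 ≤ C₀) (hα0 : 0 ≤ α) (hα1 : α ≤ 1) {γ a b x₀ ξ₀ : ℝ} (hx₀ : |x₀| ≤ 1) (hab : a ≤ b)
    (ha : -1 ≤ a) (hb : b ≤ 1) (hξ₀ : ξ₀ ∈ Icc a b) {n : ℕ} (hn : 1 ≤ n)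
    (hs : b - a ≤ 1 / n) {P : ℝ → ℝ} (hP : Continuous P) (hP0 : ∀ ξ ∈ Icc a b, 0 ≤ P ξ) :
    ‖((∫ ξ in a..b, P ξ) * ∫ x in (-1 : ℝ)..1, (1 - (x - x₀) ^ 2 / 4) ^ n) •
        g x₀ (ξ₀ * x₀ + γ) - pencilPairing g γ a b P fun x => (1 - (x - x₀) ^ 2 / 4) ^ n‖ ≤
      19 * C₀ * (1 / √n) ^ α *
        ((∫ ξ in a..b, P ξ) * ∫ x in (-1 : ℝ)..1, (1 - (x - x₀) ^ 2 / 4) ^ n) := by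
  have hn' : (1 : ℝ) ≤ n := by exact_mod_cast hn
  set v := g x₀ (ξ₀ * x₀ + γ) with hv
  set K : ℝ → ℝ := fun x => (1 - (x - x₀) ^ 2 / 4) ^ n with hK
  have hKc : Continuous K := by fun_prop
  have hl : ∀ ξ, Continuous fun x => g x (ξ * x + γ) := fun ξ =>
    hg.continuous.iterPrimitive 0 continuous_id (by fun_prop)
  obtain ⟨h1, h2⟩ := abs_le.1 hx₀
  have hK0 : ∀ x ∈ Icc (-1 : ℝ) 1, 0 ≤ K x := fun x hx => by
    have : |x - x₀| ≤ 2 := by rw [abs_le]; constructor <;> linarith [hx.1, hx.2]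
    have := sq_le_sq' (by linarith [abs_le.1 this]) (abs_le.1 this).2
    exact pow_nonneg (by linarith) n
  have hinner : ∀ ξ, (∫ x in (-1 : ℝ)..1, K x) • v - ∫ x in (-1 : ℝ)..1, K x • g x (ξ * x + γ) =
      ∫ x in (-1 : ℝ)..1, K x • (v - g x (ξ * x + γ)) := by
    intro ξ
    rw [← intervalIntegral.integral_smul_const, ← intervalIntegral.integral_sub
      (intervalIntegrable_smul hKc continuous_const _ _)
      (intervalIntegrable_smul hKc (hl ξ) _ _)]
    simp_rw [smul_sub]
  have hbound : ∀ ξ ∈ Icc a b,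
      ‖(∫ x in (-1 : ℝ)..1, K x) • v - ∫ x in (-1 : ℝ)..1, K x • g x (ξ * x + γ)‖ ≤
        19 * C₀ * (1 / √n) ^ α * ∫ x in (-1 : ℝ)..1, K x := by
    intro ξ hξ
    rw [hinner]
    -- Here `rpow_le_rpow_mul_one_add_sq` is used at the kernel's scale $h=n^{-1/2}$. The second
    -- moment turns $8n(x-x_0)^2$ into at most $16$, and $3+16=19$.
    have hpt : ∀ x ∈ Icc (-1 : ℝ) 1, ‖K x • (v - g x (ξ * x + γ))‖ ≤
        C₀ * (1 / √n) ^ α * (3 * K x + 8 * n * ((x - x₀) ^ 2 * K x)) := by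
      intro x hx
      rw [norm_smul, Real.norm_of_nonneg (hK0 x hx)]
      have hξs : |ξ₀ - ξ| ≤ 1 / n := by
        rw [abs_le]; constructor <;> linarith [hξ.1, hξ.2, hξ₀.1, hξ₀.2]
      have hξ1 : |ξ| ≤ 1 := by rw [abs_le]; constructor <;> linarith [hξ.1, hξ.2]
      have hd : |x₀ - x| + |ξ₀ * x₀ + γ - (ξ * x + γ)| ≤ 2 * |x - x₀| + 1 / n := by
        have e : ξ₀ * x₀ + γ - (ξ * x + γ) = ξ * (x₀ - x) + (ξ₀ - ξ) * x₀ := by ring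
        have e1 : |ξ * (x₀ - x)| ≤ |x₀ - x| := by
          rw [abs_mul]; exact mul_le_of_le_one_left (abs_nonneg _) hξ1
        have e2 : |(ξ₀ - ξ) * x₀| ≤ 1 / n := by
          rw [abs_mul]; exact (mul_le_of_le_one_right (abs_nonneg _) hx₀).trans hξs
        rw [e, abs_sub_comm x x₀]
        linarith [abs_add_le (ξ * (x₀ - x)) ((ξ₀ - ξ) * x₀)]
      have hn0 : (0 : ℝ) < 1 / n := by positivity
      have hsq : ((2 * |x - x₀| + 1 / n) / (1 / √n)) ^ 2 ≤ 8 * n * (x - x₀) ^ 2 + 2 := by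
        rw [div_pow, div_pow, sq_sqrt (by positivity), one_pow, div_le_iff₀ hn0]
        have e1 : (8 * n * (x - x₀) ^ 2 + 2) * (1 / n : ℝ) = 8 * (x - x₀) ^ 2 + 2 * (1 / n) := by
          field_simp
        have e2 : (1 / n : ℝ) ^ 2 ≤ 1 / n := by
          rw [sq]; exact mul_le_of_le_one_left hn0.le ((div_le_one (by linarith)).2 hn')
        rw [e1, ← sq_abs (x - x₀)]
        nlinarith [sq_nonneg (2 * |x - x₀| - 1 / n)]
      have hh := rpow_le_rpow_mul_one_add_sq hα0 hα1 (d := 2 * |x - x₀| + 1 / n)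
        (h := 1 / √n) (by positivity) (by positivity)
      calc K x * ‖v - g x (ξ * x + γ)‖
          ≤ K x * (C₀ * ((1 / √n) ^ α * (1 + (8 * n * (x - x₀) ^ 2 + 2)))) := by
            refine mul_le_mul_of_nonneg_left ?_ (hK0 x hx)
            refine (hg.holder _ _ _ _).trans (mul_le_mul_of_nonneg_left ?_ hC₀)
            refine (rpow_le_rpow (by positivity) hd hα0).trans (hh.trans ?_)
            gcongr
        _ = _ := by ring
    refine (intervalIntegral.norm_integral_le_integral_norm (by norm_num)).trans ?_
    refine (intervalIntegral.integral_mono_on (by norm_num)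
      ((hKc.smul (continuous_const.sub (hl ξ))).norm.intervalIntegrable _ _)
      (by apply Continuous.intervalIntegrable; fun_prop) hpt).trans ?_
    rw [intervalIntegral.integral_const_mul, intervalIntegral.integral_add
      (by apply Continuous.intervalIntegrable; fun_prop)
      (by apply Continuous.intervalIntegrable; fun_prop), intervalIntegral.integral_const_mul,
      intervalIntegral.integral_const_mul]
    have hm := integral_sq_mul_landau_le hx₀ n
    have hKi : 0 ≤ ∫ x in (-1 : ℝ)..1, K x :=
      intervalIntegral.integral_nonneg (by norm_num) hK0
    have hm2 : 8 * n * ∫ x in (-1 : ℝ)..1, (x - x₀) ^ 2 * K x ≤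
        16 * ∫ x in (-1 : ℝ)..1, K x := by
      calc 8 * n * ∫ x in (-1 : ℝ)..1, (x - x₀) ^ 2 * K x
          ≤ 8 * n * (2 / ((n : ℝ) + 1) * ∫ x in (-1 : ℝ)..1, K x) := by gcongr
        _ = 16 * (n / ((n : ℝ) + 1)) * ∫ x in (-1 : ℝ)..1, K x := by ring
        _ ≤ 16 * 1 * ∫ x in (-1 : ℝ)..1, K x := by
            gcongr
            exact (div_le_one (by linarith)).2 (by linarith)
        _ = _ := by ring
    calc _ ≤ C₀ * (1 / √n) ^ α *
          (3 * (∫ x in (-1 : ℝ)..1, K x) + 16 * ∫ x in (-1 : ℝ)..1, K x) := by gcongr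
      _ = _ := by ring
  have hci := continuous_inner_pairing hg.continuous γ hKc
  have houter : ((∫ ξ in a..b, P ξ) * ∫ x in (-1 : ℝ)..1, K x) • v - pencilPairing g γ a b P K =
      ∫ ξ in a..b, P ξ • ((∫ x in (-1 : ℝ)..1, K x) • v -
        ∫ x in (-1 : ℝ)..1, K x • g x (ξ * x + γ)) := by
    rw [mul_smul, ← intervalIntegral.integral_smul_const, pencilPairing,
      ← intervalIntegral.integral_sub (intervalIntegrable_smul hP continuous_const _ _)
      (intervalIntegrable_smul hP hci _ _)]
    simp_rw [smul_sub]
  rw [houter]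
  refine (intervalIntegral.norm_integral_le_integral_norm hab).trans ?_
  rw [show 19 * C₀ * (1 / √n) ^ α * ((∫ ξ in a..b, P ξ) * ∫ x in (-1 : ℝ)..1, K x) =
    ∫ ξ in a..b, P ξ * (19 * C₀ * (1 / √n) ^ α * ∫ x in (-1 : ℝ)..1, K x) by
      rw [intervalIntegral.integral_mul_const]; ring]
  refine intervalIntegral.integral_mono_on hab
    ((hP.smul (continuous_const.sub hci)).norm.intervalIntegrable _ _)
    ((hP.mul continuous_const).intervalIntegrable _ _) fun ξ hξ => ?_
  rw [norm_smul, Real.norm_of_nonneg (hP0 ξ hξ)]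
  exact mul_le_mul_of_nonneg_left (hbound ξ hξ) (hP0 ξ hξ)

/-! ### Lower bounds for the masses and the pointwise estimate. -/

/-- On the middle half of $[a,b]$ both factors are at least $(b-a)/4$. -/
theorem le_integral_weight {a b : ℝ} (hab : a ≤ b) (m : ℕ) :
    ((b - a) / 4) ^ (2 * m + 1) ≤ ∫ ξ in a..b, (ξ - a) ^ m * (b - ξ) ^ m := by
  set s := b - a with hs
  have hs0 : 0 ≤ s := by linarith
  calc (s / 4) ^ (2 * m + 1) ≤ s / 2 * ((s / 4) ^ m * (s / 4) ^ m) := by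
        rw [pow_succ, two_mul, pow_add, mul_comm]; gcongr; norm_num
    _ = ∫ ξ in (a + s / 4)..(b - s / 4), (s / 4) ^ m * (s / 4) ^ m := by
        rw [intervalIntegral.integral_const, smul_eq_mul]; congr 1; rw [hs]; ring
    _ ≤ ∫ ξ in (a + s / 4)..(b - s / 4), (ξ - a) ^ m * (b - ξ) ^ m := by
        refine intervalIntegral.integral_mono_on (by linarith) (by simp)
          (by apply Continuous.intervalIntegrable; fun_prop) fun ξ hξ => ?_
        have e1 : s / 4 ≤ ξ - a := by linarith [hξ.1]
        have e2 : s / 4 ≤ b - ξ := by linarith [hξ.2]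
        have e3 : 0 ≤ (ξ - a) ^ m := pow_nonneg (by linarith) m
        gcongr
    _ ≤ ∫ ξ in a..b, (ξ - a) ^ m * (b - ξ) ^ m := by
        refine intervalIntegral.integral_mono_interval (by linarith) (by linarith) (by linarith)
          ?_ (by apply Continuous.intervalIntegrable; fun_prop)
        filter_upwards [ae_restrict_mem measurableSet_Ioc] with ξ hξ
        exact mul_nonneg (pow_nonneg (by linarith [hξ.1]) _) (pow_nonneg (by linarith [hξ.2]) _)

/-- Here $|x-x_0|\le3/2$, so the base is at least $7/16$. -/
theorem le_integral_landau {x₀ : ℝ} (hx₀ : |x₀| ≤ 1 / 2) (n : ℕ) :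
    (1 / 4 : ℝ) ^ n ≤ ∫ x in (-1 : ℝ)..1, (1 - (x - x₀) ^ 2 / 4) ^ n := by
  obtain ⟨h1, h2⟩ := abs_le.1 hx₀
  calc (1 / 4 : ℝ) ^ n ≤ ∫ x in (-1 : ℝ)..1, (1 / 4 : ℝ) ^ n := by
        rw [intervalIntegral.integral_const, smul_eq_mul]
        linarith [show (0 : ℝ) ≤ (1 / 4) ^ n by positivity]
    _ ≤ _ := by
        refine intervalIntegral.integral_mono_on (by norm_num) (by simp)
          (by apply Continuous.intervalIntegrable; fun_prop) fun x hx => ?_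
        gcongr
        have := sq_le_sq' (a := x - x₀) (b := 3 / 2) (by linarith [hx.1]) (by linarith [hx.2])
        linarith

/-- The quantitative estimate behind the theorem, with a free parameter `n`. -/
theorem norm_le_of_data {C₀ α : ℝ} {g : ℝ → ℝ → ℂ} (hg : HolderAboveParabola C₀ α g)
    (hC₀ : 0 ≤ C₀) (hα0 : 0 ≤ α) (hα1 : α ≤ 1) {γ ε τ : ℝ} (hε : 0 < ε) (hε1 : ε ≤ 1) (hτ : 0 ≤ τ)
    (hdata : ∀ l, ∫ ξ in Icc (-ε) ε, ‖lineMoment g 0 l ξ γ‖ ≤ 2 ^ l * τ)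
    {x₀ ξ₀ : ℝ} (hx₀ : |x₀| ≤ 1 / 2) (hξ₀ : |ξ₀| ≤ ε) {n : ℕ} (hn : 1 ≤ n) :
    ‖g x₀ (ξ₀ * x₀ + γ)‖ ≤ 19 * C₀ * (1 / √n) ^ α + (8 * n / ε) ^ (8 * n) * τ := by
  have hn' : (1 : ℝ) ≤ n := by exact_mod_cast hn
  have hs : ε / n ≤ ε := div_le_self hε.le hn'
  have hs0 : 0 < ε / n := by positivity
  have hs1 : ε / n ≤ 1 / n := by gcongr
  obtain ⟨h1, h2⟩ := abs_le.1 hξ₀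
  -- Taking $\xi_0$ as an endpoint, on the side facing $0$, keeps the interval inside
  -- $[-\varepsilon,\varepsilon]$ even when $|\xi_0|=\varepsilon$.
  obtain ⟨a, b, hba, ha, hb, hmem⟩ : ∃ a b : ℝ, b - a = ε / n ∧ -ε ≤ a ∧ b ≤ ε ∧ ξ₀ ∈ Icc a b := by
    rcases le_total 0 ξ₀ with h | h
    · exact ⟨ξ₀ - ε / n, ξ₀, by ring, by linarith, h2, by linarith, le_rfl⟩
    · exact ⟨ξ₀, ξ₀ + ε / n, by ring, h1, by linarith, le_rfl, by linarith⟩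
  have hx₁ : |x₀| ≤ 1 := by linarith
  have hab : a ≤ b := by linarith
  set P : ℝ → ℝ := fun ξ => (ξ - a) ^ (2 * n) * (b - ξ) ^ (2 * n) with hP
  set Z := (∫ ξ in a..b, P ξ) * ∫ x in (-1 : ℝ)..1, (1 - (x - x₀) ^ 2 / 4) ^ n with hZ
  have e1 := norm_sub_pencilPairing_le hg hC₀ hα0 hα1 (γ := γ) hx₁ hab (by linarith) (by linarith)
    hmem hn (by linarith) (P := P) (by fun_prop) fun ξ hξ => mul_nonneg
      (pow_nonneg (by linarith [hξ.1]) _) (pow_nonneg (by linarith [hξ.2]) _)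
  have e2 := norm_pencilPairing_landau_le hg.continuous hx₁ hab (by linarith) ha hb hτ hdata hn
  have hQ1 : 1 ≤ 8 * n / ε := by rw [le_div_iff₀ hε]; linarith
  have hZl : (ε / n / 4) ^ (2 * (2 * n) + 1) * (1 / 4) ^ n ≤ Z := by
    rw [hZ, ← hba]
    have := le_integral_weight hab (2 * n)
    have := le_integral_landau hx₀ n
    gcongr
    exact (show (0 : ℝ) ≤ ((b - a) / 4) ^ (2 * (2 * n) + 1) by
      rw [hba]; positivity).trans (le_integral_weight hab (2 * n))
  have hZ0 : 0 < Z := lt_of_lt_of_le (by positivity) hZl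
  have hfac : 2 ^ n * (8 * n : ℝ) ^ (2 * n) ≤ (8 * n / ε) ^ (8 * n) * Z := by
    refine le_trans ?_ (mul_le_mul_of_nonneg_left hZl (by positivity))
    have k1 : (8 * n / ε) ^ (4 * n + 1) * (ε / n / 4) ^ (2 * (2 * n) + 1) = 2 ^ (4 * n + 1) := by
      rw [show 2 * (2 * n) + 1 = 4 * n + 1 by ring, ← mul_pow]
      congr 1
      field_simp
      norm_num
    have k2 : (8 : ℝ) ^ n ≤ (8 * n / ε) ^ n := by
      gcongr
      rw [le_div_iff₀ hε]; nlinarith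
    have k3 : (8 * n : ℝ) ^ (2 * n) ≤ (8 * n / ε) ^ (2 * n) := by
      gcongr
      rw [le_div_iff₀ hε]; nlinarith
    -- The exponents add up to $7n+1\le8n$, as $n\ge1$.
    have k4 : (8 * n / ε) ^ (n + 2 * n + (4 * n + 1)) ≤ (8 * n / ε) ^ (8 * n) :=
      pow_le_pow_right₀ hQ1 (by omega)
    calc (2 : ℝ) ^ n * (8 * n : ℝ) ^ (2 * n) = 8 ^ n * (8 * n : ℝ) ^ (2 * n) * 1 * (1 / 4) ^ n := by
          rw [show (2 : ℝ) = 8 * (1 / 4) by norm_num, mul_pow]; norm_num; ring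
      _ ≤ (8 * n / ε) ^ n * (8 * n / ε) ^ (2 * n) * 2 ^ (4 * n + 1) * (1 / 4) ^ n := by
          gcongr
          exact one_le_pow₀ (by norm_num)
      _ = (8 * n / ε) ^ (n + 2 * n + (4 * n + 1)) * (ε / n / 4) ^ (2 * (2 * n) + 1) *
            (1 / 4) ^ n := by rw [← k1]; ring
      _ ≤ (8 * n / ε) ^ (8 * n) * ((ε / n / 4) ^ (2 * (2 * n) + 1) * (1 / 4) ^ n) := by
          rw [mul_assoc]; gcongr
  have hv : ‖Z • g x₀ (ξ₀ * x₀ + γ)‖ ≤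
      19 * C₀ * (1 / √n) ^ α * Z + 2 ^ n * ((8 * n) ^ (2 * n) * τ) :=
    (norm_le_norm_sub_add _ _).trans (add_le_add e1 e2)
  rw [norm_smul, Real.norm_of_nonneg hZ0.le] at hv
  refine le_of_mul_le_mul_left (hv.trans ?_) hZ0
  have := mul_le_mul_of_nonneg_right hfac hτ
  linarith

/-! ### From point values to means, and the choice of $n$. -/

/-- `radonMean` is an average of values of `f` over the points `(x, ξ x + γ)`, `|ξ| ≤ ε`. -/
theorem norm_radonMean_le {φ : ℝ → ℝ} (hφ : IsTestFunction φ) {ε γ x B : ℝ} (hε : 0 < ε)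
    {f : EuclideanSpace ℝ (Fin 2) → ℂ} (h : ∀ ξ, |ξ| ≤ ε → ‖f !₂[x, ξ * x + γ]‖ ≤ B) :
    ‖radonMean φ ε γ f x‖ ≤ B := by
  have hB : 0 ≤ B := (norm_nonneg _).trans (h 0 (by simpa using hε.le))
  rw [radonMean]
  split_ifs with hx
  · subst hx
    simpa using h 0 (by simpa using hε.le)
  · set s := ε * |x| with hs
    have hs0 : 0 < s := mul_pos hε (abs_pos.2 hx)
    have hφi : Integrable φ := by
      refine hφ.smooth.continuous.integrable_of_hasCompactSupport ?_
      exact isCompact_Icc.of_isClosed_subset (isClosed_tsupport φ) hφ.supp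
    have hd0 : ∀ t, 0 ≤ dilate φ s t := fun t =>
      mul_nonneg (by positivity) (hφ.nonneg _)
    have hdi : Integrable fun y => dilate φ s (γ - y) :=
      ((hφi.comp_div hs0.ne').const_mul (1 / s)).comp_sub_left γ
    have hd1 : ∫ y, dilate φ s (γ - y) = 1 := by
      rw [integral_sub_left_eq_self (fun y => dilate φ s y) volume γ]
      simp only [dilate]
      rw [integral_const_mul, Measure.integral_comp_div, hφ.integral_eq_one, abs_of_pos hs0]
      simp [hs0.ne']
    have hS : MeasurableSet {y : ℝ | |y - γ| ≤ s} :=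
      measurableSet_le (by fun_prop) measurable_const
    calc _ ≤ ∫ y in {y : ℝ | |y - γ| ≤ s}, B * dilate φ s (γ - y) := by
          refine norm_integral_le_of_norm_le (hdi.const_mul B).integrableOn ?_
          filter_upwards [ae_restrict_mem hS] with y hy
          rw [norm_mul, Complex.norm_real, Real.norm_of_nonneg (hd0 _)]
          refine mul_le_mul_of_nonneg_right ?_ (hd0 _)
          -- The point $(x,y)$ lies on the line through $(0,\gamma)$ of slope $(y-\gamma)/x$.
          have := h ((y - γ) / x) (by rw [abs_div, div_le_iff₀ (abs_pos.2 hx)]; exact hy)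
          rwa [div_mul_cancel₀ _ hx, sub_add_cancel] at this
      _ ≤ ∫ y, B * dilate φ s (γ - y) :=
          setIntegral_le_integral (hdi.const_mul B)
            (Filter.Eventually.of_forall fun y => mul_nonneg hB (hd0 _))
      _ = B := by rw [integral_const_mul, hd1, mul_one]

/-- Optimal choice of the free parameter. -/
theorem exists_parameter {K Q c₀ α ρ : ℝ} (hK : 0 ≤ K) (hQ : 1 ≤ Q) (hc₀ : 0 ≤ c₀) (hρ : 0 < ρ)
    (hρα : ρ < α / 2) :
    ∃ L₀ : ℝ, 0 < L₀ ∧ ∀ L ≥ L₀, ∃ n : ℕ, 1 ≤ n ∧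
      K * (1 / √n) ^ α + (Q * n) ^ (8 * n) * (c₀ * exp (-L)) ≤ L ^ (-ρ) := by
  have hα : 0 < α := by linarith
  -- With $n=\lceil L^\theta\rceil$, $\theta>2\rho/\alpha$ makes $n^{-\alpha/2}=o(L^{-\rho})$ and
  -- $\theta<1$ makes $n\log n=o(L)$.
  obtain ⟨θ, hθl, hθ1⟩ : ∃ θ, 2 * ρ / α < θ ∧ θ < 1 :=
    exists_between ((div_lt_one hα).2 (by linarith))
  have hθ0 : 0 < θ := lt_trans (by positivity) hθl
  have hρθ : ρ < θ * (α / 2) := by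
    rw [div_lt_iff₀ hα] at hθl; linarith
  have t1 : Filter.Tendsto (fun L : ℝ => K * L ^ (-(θ * (α / 2) - ρ))) Filter.atTop (nhds 0) := by
    simpa using (tendsto_rpow_neg_atTop (sub_pos.2 hρθ)).const_mul K
  have t2 : Filter.Tendsto (fun L : ℝ => c₀ * (L ^ ρ * exp (-(1 / 2) * L))) Filter.atTop
      (nhds 0) := by
    simpa using (tendsto_rpow_mul_exp_neg_mul_atTop_nhds_zero ρ (1 / 2) (by norm_num)).const_mul c₀
  have o3 : (fun L : ℝ => log (2 * Q) + θ * log L) =o[Filter.atTop] fun L => L ^ (1 - θ) := by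
    refine Asymptotics.IsLittleO.add ?_ ((isLittleO_log_rpow_atTop (sub_pos.2 hθ1)).const_mul_left θ)
    refine Asymptotics.isLittleO_const_left.2 (Or.inr ?_)
    exact tendsto_norm_atTop_atTop.comp (tendsto_rpow_atTop (sub_pos.2 hθ1))
  -- The value $1/32$ gives $8n\log(Qn)\le16L^\theta\cdot L^{1-\theta}/32=L/2$, leaving half of the
  -- decay $e^{-L}$.
  have ev := ((t1.eventually_le_const (show (0 : ℝ) < 1 / 2 by norm_num)).and
    (t2.eventually_le_const (show (0 : ℝ) < 1 / 2 by norm_num))).and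
    (o3.bound (show (0 : ℝ) < 1 / 32 by norm_num))
  obtain ⟨L₁, hL₁⟩ := Filter.eventually_atTop.1 ev
  refine ⟨max L₁ 1, by positivity, fun L hL => ?_⟩
  have hL1 : 1 ≤ L := (le_max_right _ _).trans hL
  have hL0 : 0 < L := by linarith
  obtain ⟨⟨h1, h2⟩, h3⟩ := hL₁ L ((le_max_left _ _).trans hL)
  have hu1 : 1 ≤ L ^ θ := one_le_rpow hL1 hθ0.le
  have hnl : L ^ θ ≤ (⌈L ^ θ⌉₊ : ℝ) := Nat.le_ceil _
  have hnu : (⌈L ^ θ⌉₊ : ℝ) ≤ 2 * L ^ θ := by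
    linarith [Nat.ceil_lt_add_one (show 0 ≤ L ^ θ by positivity)]
  set n := ⌈L ^ θ⌉₊ with hn
  have hn1 : (1 : ℝ) ≤ n := hu1.trans hnl
  refine ⟨n, by exact_mod_cast hn1, ?_⟩
  have a1 : (1 / √n) ^ α ≤ L ^ (-(θ * (α / 2))) := by
    rw [one_div, inv_rpow (sqrt_nonneg _), sqrt_eq_rpow, ← rpow_mul (by positivity),
      rpow_neg hL0.le, rpow_mul hL0.le, show 1 / 2 * α = α / 2 by ring]
    gcongr
  have a2 : (Q * n) ^ (8 * n) ≤ exp (L / 2) := by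
    have hQn : 0 < Q * n := by positivity
    rw [← exp_log (pow_pos hQn _), log_pow, exp_le_exp]
    have e0 : 0 ≤ log (Q * n) := log_nonneg (by nlinarith)
    have e1 : log (Q * n) ≤ log (2 * Q) + θ * log L := by
      rw [← log_rpow hL0, ← log_mul (by positivity) (by positivity)]
      refine log_le_log hQn ?_
      nlinarith
    have e2 : log (2 * Q) + θ * log L ≤ 1 / 32 * L ^ (1 - θ) := by
      rw [Real.norm_of_nonneg (show 0 ≤ L ^ (1 - θ) by positivity)] at h3
      exact (le_abs_self _).trans h3
    calc ((8 * n : ℕ) : ℝ) * log (Q * n) ≤ (8 * (2 * L ^ θ)) * (1 / 32 * L ^ (1 - θ)) := by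
          push_cast
          have := e1.trans e2
          gcongr
      _ = 1 / 2 * (L ^ θ * L ^ (1 - θ)) := by ring
      _ = L / 2 := by rw [← rpow_add hL0, add_sub_cancel, rpow_one]; ring
  have b1 : K * (1 / √n) ^ α ≤ 1 / 2 * L ^ (-ρ) := by
    calc K * (1 / √n) ^ α ≤ K * L ^ (-(θ * (α / 2))) := by gcongr
      _ = K * L ^ (-(θ * (α / 2) - ρ)) * L ^ (-ρ) := by
          rw [mul_assoc, ← rpow_add hL0]; congr 2; ring
      _ ≤ _ := by gcongr
  have b2 : (Q * n) ^ (8 * n) * (c₀ * exp (-L)) ≤ 1 / 2 * L ^ (-ρ) := by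
    calc (Q * n) ^ (8 * n) * (c₀ * exp (-L)) ≤ exp (L / 2) * (c₀ * exp (-L)) := by gcongr
      _ = c₀ * (L ^ ρ * exp (-(1 / 2) * L)) * L ^ (-ρ) := by
          rw [show exp (L / 2) * (c₀ * exp (-L)) = c₀ * (exp (L / 2) * exp (-L)) by ring,
            ← exp_add, show L / 2 + -L = -(1 / 2) * L by ring,
            show c₀ * (L ^ ρ * exp (-(1 / 2) * L)) * L ^ (-ρ) =
              c₀ * exp (-(1 / 2) * L) * (L ^ ρ * L ^ (-ρ)) by ring, ← rpow_add hL0]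
          simp
      _ ≤ _ := by gcongr
  linarith

/-- The free upper bound $t$ lets vanishing data be treated through $t=e^{-L}$ with $L\to\infty$. -/
theorem norm_radonMean_le_of_dataNorm {c₀ ε γ : ℝ} {C₀ α : ℝ≥0} (hc₀ : 0 < c₀) (hα0 : 0 < α)
    (hα1 : α ≤ 1) (hε : 0 < ε) (hγ : 0 < γ) (hεγ : ε + γ ≤ 1) {nrm : (ℝ → ℝ → ℂ) → ℝ}
    (hnrm : IsDataNorm c₀ ε γ nrm) {φ : ℝ → ℝ} (hφ : IsTestFunction φ)
    {f : EuclideanSpace ℝ (Fin 2) → ℂ} (hf : HolderWith C₀ α f)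
    (hs : tsupport f ⊆ {p | (p 0) ^ 2 ≤ p 1}) {t : ℝ} (ht0 : 0 ≤ t) (ht : nrm (radon f) ≤ t)
    {x : ℝ} (hx : |x| ≤ 1 / 2) {n : ℕ} (hn : 1 ≤ n) :
    ‖radonMean φ ε γ f x‖ ≤ 19 * C₀ * (1 / √n) ^ (α : ℝ) + (8 / ε * n) ^ (8 * n) * (c₀ * t) := by
  have hg := holderAboveParabola_of_holderWith hα0 hf hs
  have hmax := (hnrm (radon f) (continuous_radon (hf.continuous hα0) hg.eq_zero)).trans
    (mul_le_mul_of_nonneg_left ht hc₀.le)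
  have h1 := (le_max_left _ _).trans hmax
  have h2 := (le_max_right _ _).trans hmax
  have hl : ∀ ξ η, |ξ| ≤ ε → η ≤ γ →
      radon f ξ η = lineMoment (fun x y => f !₂[x, y]) 0 0 ξ η := fun ξ η hξ hη =>
    radon_eq_lineMoment hg.eq_zero hγ.le hεγ hξ hη
  rw [setIntegral_congr_fun (g := fun p => ‖lineMoment (fun x y => f !₂[x, y]) 0 0 p.1 p.2‖)
    (s := dataRect ε γ) (measurableSet_Icc.prod measurableSet_Icc)
    fun p hp => by simp only [hl p.1 p.2 (abs_le.2 hp.1) hp.2.2]] at h1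
  rw [setIntegral_congr_fun (g := fun ξ => ‖lineMoment (fun x y => f !₂[x, y]) 0 0 ξ γ‖)
    measurableSet_Icc fun ξ hξ => by simp only [hl ξ γ (abs_le.2 hξ) le_rfl]] at h2
  have hdata := integral_norm_lineMoment_le hg.continuous hg.eq_zero hε hγ hεγ h1 h2
  refine norm_radonMean_le hφ hε fun ξ hξ => ?_
  rw [div_mul_eq_mul_div]
  exact norm_le_of_data hg C₀.coe_nonneg α.coe_nonneg (by exact_mod_cast hα1) hε (by linarith)
    (by positivity) hdata hx hξ hn

theorem mainTheorem3 (c₀ : ℝ) (hc₀ : 0 < c₀) :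
    ∃ C : ℝ, 1 ≤ C ∧ ∃ M : ℝ≥0 → ℝ, (∀ C₀, 0 < M C₀) ∧
      ∀ (α : ℝ≥0) (ρ : ℝ), 1 / 2 < α → α ≤ 1 → 0 < ρ → ρ < α - 1 / 2 →
        ∃ c : ℝ, 0 < c ∧ ∀ (C₀ : ℝ≥0) (ε : ℝ), 0 < ε → ε < 1 →
          ∃ δ : ℝ, 0 < δ ∧ δ < M C₀ ∧
            ∀ (γ : ℝ) (nrm : (ℝ → ℝ → ℂ) → ℝ) (φ : ℝ → ℝ) (f : EuclideanSpace ℝ (Fin 2) → ℂ),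
              0 < γ → ε + γ ≤ 1 → IsDataNorm c₀ ε γ nrm → IsTestFunction φ →
              HolderWith C₀ α f → tsupport f ⊆ {p | (p 0) ^ 2 ≤ p 1} →
              nrm (radon f) < δ →
                (nrm (radon f) = 0 → ∀ x : ℝ, |x| ≤ 1 / 2 → radonMean φ ε γ f x = 0) ∧
                (0 < nrm (radon f) → ∀ x : ℝ, |x| ≤ 1 / 2 →
                  ‖radonMean φ ε γ f x‖ ≤
                    c * M C₀ * (log (C / ε) / log (M C₀ / nrm (radon f))) ^ ρ) := by
  -- Since $\delta$ may depend on $C_0$ and $\varepsilon$, the constants $C=e$, $M=1$, $c=1$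
  -- suffice; $\log(e/\varepsilon)\ge1$ only enlarges the bound.
  refine ⟨exp 1, one_le_exp zero_le_one, fun _ => 1, fun _ => one_pos, ?_⟩
  intro α ρ hα hα1 hρ hρα
  refine ⟨1, one_pos, fun C₀ ε hε hε1 => ?_⟩
  have hα0 : 0 < α := lt_of_le_of_lt (by positivity) hα
  have hα1' : (α : ℝ) ≤ 1 := by exact_mod_cast hα1
  -- The condition $\rho<\alpha/2$ follows from $\rho<\alpha-\frac12\le\alpha/2$, where $\alpha\le1$
  -- enters.
  obtain ⟨L₀, hL₀, hpar⟩ := exists_parameter (K := 19 * C₀) (Q := 8 / ε) (c₀ := c₀) (α := α)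
    (by positivity) (by rw [le_div_iff₀ hε]; linarith) hc₀.le hρ (by linarith)
  refine ⟨exp (-L₀), exp_pos _, exp_lt_one_iff.2 (by linarith), ?_⟩
  intro γ nrm φ f hγ hεγ hnrm hφ hf hs hδ
  have key : ∀ L ≥ L₀, nrm (radon f) ≤ exp (-L) → ∀ x : ℝ, |x| ≤ 1 / 2 →
      ‖radonMean φ ε γ f x‖ ≤ L ^ (-ρ) := by
    intro L hL ht x hx
    obtain ⟨n, hn, hb⟩ := hpar L hL
    exact (norm_radonMean_le_of_dataNorm hc₀ hα0 hα1 hε hγ hεγ hnrm hφ hf hs (exp_pos _).le ht hx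
      hn).trans hb
  refine ⟨fun h0 x hx => ?_, fun hpos x hx => ?_⟩
  · refine norm_le_zero_iff.1 (ge_of_tendsto (tendsto_rpow_neg_atTop hρ) ?_)
    filter_upwards [Filter.eventually_ge_atTop L₀] with L hL
    exact key L hL (h0.trans_le (exp_pos _).le) x hx
  · have hlog : log (1 / nrm (radon f)) = -log (nrm (radon f)) := by rw [one_div, log_inv]
    have hL : L₀ ≤ log (1 / nrm (radon f)) := by
      have := log_lt_log hpos hδ
      rw [log_exp] at this
      linarith
    have hL0 := hL₀.trans_le hL
    have hb := key _ hL (by rw [hlog, neg_neg, exp_log hpos]) x hx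
    have hC : 1 ≤ log (exp 1 / ε) := by
      rw [log_div (exp_ne_zero 1) hε.ne', log_exp]
      linarith [log_neg hε hε1]
    rw [one_mul, one_mul]
    refine hb.trans ?_
    rw [rpow_neg hL0.le, ← inv_rpow hL0.le, ← one_div]
    gcongr
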